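/- Let $(X,Y)$ be a random vector on a probability space, where $X$ is real valued with distribution $F$ and $Y$ is (almost surely) positive with distribution $G$; write $\overline F(x)=\mathrm P(X>x)$ and $\overline G(x)=\mathrm P(Y>x)$. All limits are for $x\to\infty$ unless stated otherwise. Let $D_Y=\{y>0:\ \mathrm P(Y\in(y-\delta,y+\delta))>0\text{ for every }\delta>0\}$, and for $x\in\mathbb R$, $y\in D_Y$ put $$\mathrm P(X>x\mid Y=y)=\lim_{t\downarrow0}\frac{\mathrm P(X>x,\ Y\in[y,y+t))}{\mathrm P(Y\in[y,y+t))}$$ whenever the denominators are positive for all $t>0$ and the limit exists. The vector $(X,Y)$ is called conditionally dependent (CD) with function $s$ if $s$ is a positive measurable function on $[0,\infty)$, the numbers $\mathrm P(X>x\mid Y=y)$ exist for all sufficiently large $x$ and all $y\in D_Y$, and $$\lim_{x\to\infty}\ \sup_{y\in D_Y}\left|\frac{\mathrm P(X>x\mid Y=y)}{\overline F(x)\,s(y)}-1\right|=0 .$$ **Theorem.** Let $(X,Y)$ be CD with function $s$. Suppose that $F$ is regularly-varying-tailed with index $\alpha\ge0$, that is, $\overline F(xy)/\overline F(x)\to y^{-\alpha}$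 for every $y>0$, and write $\overline F(x)\sim x^{-\alpha}L(x)$ with $L$ positive and slowly varying at infinity ($L(xy)\sim L(x)$ for every $y>0$). Suppose also that $\overline G(x)=o(\overline F(x))$. Assume that either (i) $\mathrm E[Y^{\alpha+\varepsilon}s(Y)]<\infty$ for some $\varepsilon>0$; or (ii) $\mathrm E[Y^{\alpha}s(Y)]<\infty$, and there is a positive function $g$ on $[0,\infty)$ such that $g(x)$ is non-increasing with limit $0$, $x\,g(x)$ is non-decreasing with limit $\infty$, $\overline G(x\,g(x))=o(\overline F(x))$, and $$\limsup_{x\to\infty}\ \sup_{1\le y\le x g(x)}\frac{L(x/y)}{L(x)}<\infty .$$ Then $\mathrm E[Y^\alpha s(Y)]<\infty$ and $$\mathrm P(XY>x)\sim \mathrm E[Y^\alpha s(Y)]\,\overline F(x)\qquad(x\to\infty).$$ -/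

import Mathlib

open MeasureTheory Filter Topology Asymptotics Set

/-- The tail `x ↦ P(X > x)` of the distribution of a real random variable `X`. -/
noncomputable def tailProb {Ω : Type*} [MeasurableSpace Ω] (P : Measure Ω) (X : Ω → ℝ)
    (x : ℝ) : ℝ :=
  P.real {ω | x < X ω}

/-- A tail function `V` is regularly varying with index `α ≥ 0`:
`V (x y) / V x → y ^ (-α)` as `x → ∞`, for each `y > 0`.
(As `y ^ (-α) ≠ 0`, this forces `V x ≠ 0` for all large `x`, hence `V x > 0` for all `x`
when `V` is the tail of a distribution.) -/
def IsRegularlyVaryingTail (V : ℝ → ℝ) (α : ℝ) : Prop :=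
  0 ≤ α ∧ ∀ y : ℝ, 0 < y → Tendsto (fun x => V (x * y) / V x) atTop (𝓝 (y ^ (-α)))

/-- `L` is positive (near infinity) and slowly varying at infinity. -/
def IsSlowlyVarying (L : ℝ → ℝ) : Prop :=
  (∀ᶠ x in atTop, 0 < L x) ∧
    ∀ y : ℝ, 0 < y → Tendsto (fun x => L (x * y) / L x) atTop (𝓝 1)

/-- The set `D_Y` of the points `y > 0` all of whose neighbourhoods are charged by the law
of `Y`. -/
def posSupport {Ω : Type*} [MeasurableSpace Ω] (P : Measure Ω) (Y : Ω → ℝ) : Set ℝ :=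
  {y | 0 < y ∧ ∀ δ : ℝ, 0 < δ → 0 < P.real {ω | Y ω ∈ Ioo (y - δ) (y + δ)}}

/-- `P(X > x | Y = y)` exists and equals `p`, that is
`p = lim_{t ↓ 0} P(X > x, Y ∈ [y, y + t)) / P(Y ∈ [y, y + t))`.
The denominators are required to be nonzero, so that the quotients make sense. -/
def HasCondTail {Ω : Type*} [MeasurableSpace Ω] (P : Measure Ω) (X Y : Ω → ℝ)
    (x y p : ℝ) : Prop :=
  (∀ t : ℝ, 0 < t → 0 < P.real {ω | Y ω ∈ Ico y (y + t)}) ∧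
    Tendsto
      (fun t : ℝ => P.real {ω | x < X ω ∧ Y ω ∈ Ico y (y + t)} /
        P.real {ω | Y ω ∈ Ico y (y + t)})
      (𝓝[>] 0) (𝓝 p)

/-- `(X, Y)` is conditionally dependent with the function `s`, a positive measurable function
on `[0, ∞)` (only its values there matter): `P(X > x | Y = y) ∼ P(X > x) s(y)` as `x → ∞`,
uniformly for `y ∈ D_Y`. The conditional probabilities `P(X > x | Y = y)` have to exist for
all `y ∈ D_Y` once `x` is large, which is what the limit relation needs. -/
structure IsCondDependent {Ω : Type*} [MeasurableSpace Ω] (P : Measure Ω) (X Y : Ω → ℝ)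
    (s : ℝ → ℝ) : Prop where
  measurable : Measurable s
  pos : ∀ y : ℝ, 0 ≤ y → 0 < s y
  uniform : ∀ ε : ℝ, 0 < ε → ∀ᶠ x in atTop, ∀ y ∈ posSupport P Y,
    ∃ p : ℝ, HasCondTail P X Y x y p ∧ |p / (tailProb P X x * s y) - 1| ≤ ε

/-- For tail functions `U`, `V`: the function `g` is positive on `[0, ∞)`, `g(x) ↓ 0`,
`x g(x) ↑ ∞` and `U (x g(x)) = o(V x)`, as `x → ∞`. -/
structure IsAuxiliary (U V g : ℝ → ℝ) : Prop where
  pos : ∀ x : ℝ, 0 ≤ x → 0 < g x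
  anti : AntitoneOn g (Ici 0)
  tendsto_zero : Tendsto g atTop (𝓝 0)
  mono : MonotoneOn (fun x => x * g x) (Ici 0)
  tendsto_atTop : Tendsto (fun x => x * g x) atTop atTop
  isLittleO : (fun x => U (x * g x)) =o[atTop] V

/-- `limsup_{x → ∞} sup_{1 ≤ y ≤ x g(x)} L(x / y) / L(x) < ∞`. -/
def HasBoundedRatio (L g : ℝ → ℝ) : Prop :=
  ∃ C : ℝ, ∀ᶠ x in atTop, ∀ y : ℝ, 1 ≤ y → y ≤ x * g x → L (x / y) / L x ≤ C

/-! Let `V` be the tail of `X` and `κ_y` the conditional law of `X` given `Y = y`. Then P(XY > x, Y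
≤ b(x)) is the integral of `κ_y (x/y, ∞)` over y ≤ b(x) against the law of `Y`. Divided by `V x`,
the integrand tends to `y^α s(y)`: conditional dependence replaces `κ_y (x/y, ∞)` by `V (x/y) s(y)`,
and regular variation replaces `V (x/y)` by `y^α V x`. Dominated convergence gives the limit
(`tendsto_tail_mul_truncated`). For y ≤ 1 the domination is monotonicity of `V`; for y ≥ 1 it is the
Potter bound with b(x) = x/m in case (i), and the bounded ratio of `L` with b(x) = x g(x) in case
(ii). The event Y > b(x) has probability o(V x) (`tail_mul_isEquivalent`).

The delicate point is that conditional dependence concerns limits of quotients over [y, y + t), not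
`κ`. For fixed x, `κ_y (x, ∞)` is the density of P(X > x, Y ∈ ·) with respect to the law of `Y`, and
one-sided differentiation of measures (`ae_le_of_tendsto_Ico_ratio`) turns bounds on those limits
into almost everywhere bounds on the density. Since `κ_y` is evaluated at x/y, the exceptional null
set must not depend on x (`ae_condDistrib_Ioi`). -/

open scoped ENNReal
open ProbabilityTheory

/-! ### One-sided differentiation of measures on the line -/

/-- If `ν [y, y + t) ≤ c μ [y, y + t)` for `y ∈ S` and `t < δ`, then `ν (S ∩ J) ≤ c μ J` for
half-open intervals `J` shorter than `δ`. -/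
theorem measure_inter_Ico_le {μ ν : Measure ℝ} {c : ℝ≥0∞} {S : Set ℝ} {δ : ℝ}
    (h : ∀ y ∈ S, ∀ t ∈ Ioo 0 δ, ν (Ico y (y + t)) ≤ c * μ (Ico y (y + t)))
    {a b : ℝ} (hab : b - a < δ) : ν (S ∩ Ico a b) ≤ c * μ (Ico a b) := by
  rcases (S ∩ Ico a b).eq_empty_or_nonempty with h0 | hne
  · simp [h0]
  have key : ∀ y ∈ S ∩ Ico a b, ν (Ico y b) ≤ c * μ (Ico a b) := by
    rintro y ⟨hyS, hya, hyb⟩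
    have := h y hyS (b - y) ⟨by linarith, by linarith⟩
    rw [add_sub_cancel] at this
    exact this.trans (mul_le_mul_right (measure_mono (Ico_subset_Ico_left hya)) c)
  have hbdd : BddBelow (S ∩ Ico a b) := ⟨a, fun y hy => hy.2.1⟩
  -- One interval starting at the infimum suffices if it is attained; otherwise intervals starting
  -- at points of the set decreasing to it exhaust the set.
  by_cases hmem : sInf (S ∩ Ico a b) ∈ S ∩ Ico a b
  · exact (measure_mono fun y hy => show y ∈ Ico (sInf (S ∩ Ico a b)) b from
      ⟨csInf_le hbdd hy, hy.2.2⟩).trans (key _ hmem)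
  · obtain ⟨u, hu, hlim, huS⟩ := exists_seq_tendsto_sInf hne hbdd
    have hsub : S ∩ Ico a b ⊆ ⋃ n, Ico (u n) b := by
      intro y hy
      have hlt : sInf (S ∩ Ico a b) < y :=
        lt_of_le_of_ne (csInf_le hbdd hy) fun e => hmem (e ▸ hy)
      obtain ⟨n, hn⟩ := (hlim.eventually (eventually_lt_nhds hlt)).exists
      exact mem_iUnion.2 ⟨n, hn.le, hy.2.2⟩
    have hmono : Monotone fun n => Ico (u n) b := fun m n hmn => Ico_subset_Ico_left (hu hmn)
    calc ν (S ∩ Ico a b) ≤ ν (⋃ n, Ico (u n) b) := measure_mono hsub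
      _ = ⨆ n, ν (Ico (u n) b) := hmono.measure_iUnion
      _ ≤ c * μ (Ico a b) := iSup_le fun n => key _ (huS n)

/-- A domination of measures on short half-open intervals extends to open sets. -/
theorem measure_le_mul_of_Ico_of_isOpen {μ ρ : Measure ℝ} {c : ℝ≥0∞} {δ : ℝ} (hδ : 0 < δ)
    (h : ∀ a b : ℝ, b - a < δ → ρ (Ico a b) ≤ c * μ (Ico a b)) {U : Set ℝ} (hU : IsOpen U) :
    ρ U ≤ c * μ U := by
  let W : ℕ → Set ℝ := fun n => {x | Metric.ball x (δ / (n + 2)) ⊆ U}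
  have hW : Monotone W := by
    intro m n hmn x hx
    refine (Metric.ball_subset_ball ?_).trans hx
    gcongr
  have hcov : U ⊆ ⋃ n, W n := by
    intro x hx
    obtain ⟨r, hr, hball⟩ := Metric.isOpen_iff.1 hU x hx
    obtain ⟨n, hn⟩ := exists_nat_gt (δ / r)
    refine mem_iUnion.2 ⟨n, (Metric.ball_subset_ball ?_).trans hball⟩
    rw [div_le_iff₀ (by positivity)]
    rw [div_lt_iff₀ hr] at hn
    nlinarith
  have key : ∀ n, ρ (W n) ≤ c * μ U := by
    intro n
    set w : ℝ := δ / (n + 2) with hw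
    have hwpos : 0 < w := by positivity
    have hwδ : w < δ := by
      rw [hw, div_lt_iff₀ (by positivity)]
      nlinarith [(n.cast_nonneg : (0 : ℝ) ≤ n)]
    -- A grid cell of mesh `w` meeting `W n` lies in `U`, so disjoint cells inside `U` cover `W n`.
    -- The `n + 2` in `w` makes the mesh strictly less than `δ`.
    let J : ℤ → Set ℝ := fun k => Ico (k • w) ((k + 1) • w)
    let K : Set ℤ := {k | J k ⊆ U}
    have hsub : W n ⊆ ⋃ k ∈ K, J k := by
      intro x hx
      have hx' : x ∈ ⋃ k : ℤ, J k := by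
        rw [iUnion_Ico_zsmul hwpos]; trivial
      obtain ⟨k, hk⟩ := mem_iUnion.1 hx'
      refine mem_iUnion₂.2 ⟨k, fun z hz => hx ?_, hk⟩
      simp only [J, mem_Ico, add_smul, one_smul] at hz hk
      rw [Metric.mem_ball, Real.dist_eq, abs_lt]
      constructor <;> linarith
    have hKU : ⋃ k ∈ K, J k ⊆ U := iUnion₂_subset fun k hk => hk
    have hdisj : K.PairwiseDisjoint J := fun i _ j _ hij => pairwise_disjoint_Ico_zsmul w hij
    calc ρ (W n) ≤ ρ (⋃ k ∈ K, J k) := measure_mono hsub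
      _ ≤ ∑' k : K, ρ (J k) := measure_biUnion_le ρ K.to_countable _
      _ ≤ ∑' k : K, c * μ (J k) := by
        refine ENNReal.tsum_le_tsum fun k => h _ _ ?_
        rwa [add_smul, one_smul, add_sub_cancel_left]
      _ = c * μ (⋃ k ∈ K, J k) := by
        rw [measure_biUnion K.to_countable hdisj fun _ _ => measurableSet_Ico]
        exact ENNReal.tsum_mul_left
      _ ≤ c * μ U := mul_le_mul_right (measure_mono hKU) c
  calc ρ U ≤ ρ (⋃ n, W n) := measure_mono hcov
    _ = ⨆ n, ρ (W n) := hW.measure_iUnion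
    _ ≤ c * μ U := iSup_le key

/-- One-sided differentiation of measures on the line: if `ν [y, y + t) ≤ c μ [y, y + t)` for
small `t`, at each `y ∈ A`, then `ν A ≤ c μ A`. -/
theorem measure_le_mul_of_eventually_Ico {μ ν : Measure ℝ} [IsFiniteMeasure μ]
    {c : ℝ≥0∞} (hc : c ≠ ∞) {A : Set ℝ}
    (h : ∀ y ∈ A, ∀ᶠ t in 𝓝[>] (0 : ℝ), ν (Ico y (y + t)) ≤ c * μ (Ico y (y + t))) :
    ν A ≤ c * μ A := by
  let S : ℕ → Set ℝ := fun n => {y ∈ A | ∀ t ∈ Ioo (0 : ℝ) (1 / (n + 1)),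
    ν (Ico y (y + t)) ≤ c * μ (Ico y (y + t))}
  have hS : Monotone S := by
    rintro m n hmn y ⟨hyA, hy⟩
    refine ⟨hyA, fun t ht => hy t ⟨ht.1, ht.2.trans_le ?_⟩⟩
    gcongr
  have hcov : A ⊆ ⋃ n, S n := by
    intro y hy
    obtain ⟨r, hr, hsub⟩ := mem_nhdsGT_iff_exists_Ioo_subset.1 (h y hy)
    obtain ⟨n, hn⟩ := exists_nat_one_div_lt (mem_Ioi.1 hr)
    exact mem_iUnion.2 ⟨n, hy, fun t ht => hsub ⟨ht.1, ht.2.trans hn⟩⟩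
  have key : ∀ n, ν (S n) ≤ c * μ A := by
    intro n
    have hle : ∀ U, A ⊆ U → IsOpen U → ν (S n) ≤ c * μ U := by
      intro U hAU hU
      -- `S n` need not be measurable; restricting `ν` to it is harmless because only intervals and
      -- supersets of `S n` are evaluated.
      have := measure_le_mul_of_Ico_of_isOpen (ρ := ν.restrict (S n)) (μ := μ) (c := c)
        (δ := 1 / ((n : ℝ) + 1)) (by positivity) (fun a b hab => by
          rw [Measure.restrict_apply measurableSet_Ico, inter_comm]
          exact measure_inter_Ico_le (fun y hy => hy.2) hab) hU
      rwa [Measure.restrict_apply_superset (fun y hy => hAU hy.1)] at this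
    rcases eq_or_ne c 0 with rfl | hc0
    · simpa using hle univ (subset_univ A) isOpen_univ
    rw [A.measure_eq_iInf_isOpen μ]
    simp_rw [ENNReal.mul_iInf_of_ne hc0 hc]
    exact le_iInf fun U => le_iInf fun hAU => le_iInf fun hU => hle U hAU hU
  calc ν A ≤ ν (⋃ n, S n) := measure_mono hcov
    _ = ⨆ n, ν (S n) := hS.measure_iUnion
    _ ≤ c * μ A := iSup_le key

/-- Density bounds from one-sided derivatives. -/
theorem ae_le_of_tendsto_Ico_ratio {μ : Measure ℝ} [IsFiniteMeasure μ] {f : ℝ → ℝ≥0∞}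
    (hf : Measurable f) [IsFiniteMeasure (μ.withDensity f)] {l u : ℝ → ℝ} (hl : Measurable l)
    (hu : Measurable u)
    (h : ∀ᵐ y ∂μ, ∃ p : ℝ, l y ≤ p ∧ p ≤ u y ∧ (∀ t : ℝ, 0 < t → 0 < μ.real (Ico y (y + t))) ∧
      Tendsto (fun t : ℝ => (μ.withDensity f).real (Ico y (y + t)) / μ.real (Ico y (y + t)))
        (𝓝[>] 0) (𝓝 p)) :
    (∀ᵐ y ∂μ, ENNReal.ofReal (l y) ≤ f y) ∧ ∀ᵐ y ∂μ, f y ≤ ENNReal.ofReal (u y) := by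
  set ν := μ.withDensity f with hν
  have htoReal : ∀ (c : NNReal) (ρ σ : Measure ℝ) [IsFiniteMeasure ρ] [IsFiniteMeasure σ]
      (J : Set ℝ), ρ.real J ≤ c * σ.real J → ρ J ≤ c * σ J := by
    intro c ρ σ _ _ J hJ
    rw [← ENNReal.toReal_le_toReal (measure_ne_top _ _)
      (ENNReal.mul_ne_top ENNReal.coe_ne_top (measure_ne_top _ _)), ENNReal.toReal_mul]
    exact hJ
  constructor
  · have key : ∀ q : ℚ, ∀ᵐ y ∂μ, (0 : ℝ) < q → (q : ℝ) < l y → ENNReal.ofReal q ≤ f y := by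
      intro q
      by_cases hq : (0 : ℝ) < q
      swap
      · exact Eventually.of_forall fun y h0 => absurd h0 hq
      set c : NNReal := (q : ℝ).toNNReal with hcdef
      have hcq : (c : ℝ) = q := Real.coe_toNNReal _ hq.le
      have hc0 : c ≠ 0 := by intro h0; rw [h0] at hcq; exact hq.ne hcq
      have hB : MeasurableSet {y | (q : ℝ) < l y} := measurableSet_lt measurable_const hl
      have hae : (fun _ => (c : ℝ≥0∞)) ≤ᵐ[μ.restrict {y | (q : ℝ) < l y}] f := by
        refine ae_le_of_forall_setLIntegral_le_of_sigmaFinite measurable_const fun t ht _ => ?_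
        rw [Measure.restrict_restrict ht, setLIntegral_const,
          ← withDensity_apply _ (ht.inter hB), ← hν]
        obtain ⟨N, hN, hNmeas, hN0⟩ := exists_measurable_superset_of_null (ae_iff.1 h)
        have hνN : ν N = 0 := withDensity_absolutelyContinuous μ f hN0
        -- A lower bound on the density is the differentiation lemma with `μ` and `ν` exchanged and
        -- constant `c⁻¹`.
        have hA : μ ((t ∩ {y | (q : ℝ) < l y}) \ N) ≤
            (c⁻¹ : NNReal) * ν ((t ∩ {y | (q : ℝ) < l y}) \ N) := by
          refine measure_le_mul_of_eventually_Ico ENNReal.coe_ne_top fun y hy => ?_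
          have hyg := not_not.1 fun hn => hy.2 (hN hn)
          obtain ⟨p, hlp, -, hpos, hlim⟩ := hyg
          have hqp : (q : ℝ) < p := lt_of_lt_of_le hy.1.2 hlp
          filter_upwards [hlim.eventually (eventually_gt_nhds hqp), self_mem_nhdsWithin]
            with r hr hr0
          refine htoReal _ _ _ _ ?_
          rw [lt_div_iff₀ (hpos r hr0)] at hr
          rw [NNReal.coe_inv, hcq, ← div_eq_inv_mul, le_div_iff₀ hq, mul_comm]
          exact hr.le
        rw [measure_sdiff_null hN0, measure_sdiff_null hνN, ENNReal.coe_inv hc0] at hA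
        rw [← ENNReal.inv_mul_le_iff (ENNReal.inv_ne_zero.2 ENNReal.coe_ne_top)
          (ENNReal.inv_ne_top.2 (ENNReal.coe_ne_zero.2 hc0)), inv_inv] at hA
        exact hA
      rw [Filter.EventuallyLE, ae_restrict_iff' hB] at hae
      filter_upwards [hae] with y hy _ hqy using hy hqy
    filter_upwards [ae_all_iff.2 key] with y hy
    refine le_of_forall_lt fun a ha => ?_
    obtain ⟨q, hq0, haq, hqb⟩ := ENNReal.lt_iff_exists_rat_btwn.1 ha
    refine haq.trans_le (hy q ?_ ?_)
    · exact Real.toNNReal_pos.1 (ENNReal.coe_pos.1 (zero_le.trans_lt haq))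
    · exact (ENNReal.ofReal_lt_ofReal_iff'.1 hqb).1
  · have key : ∀ q : ℚ, ∀ᵐ y ∂μ, (0 : ℝ) ≤ q → u y < (q : ℝ) → f y ≤ ENNReal.ofReal q := by
      intro q
      by_cases hq : (0 : ℝ) ≤ q
      swap
      · exact Eventually.of_forall fun y h0 => absurd h0 hq
      set c : NNReal := (q : ℝ).toNNReal with hcdef
      have hcq : (c : ℝ) = q := Real.coe_toNNReal _ hq
      have hB : MeasurableSet {y | u y < (q : ℝ)} := measurableSet_lt hu measurable_const
      have hae : f ≤ᵐ[μ.restrict {y | u y < (q : ℝ)}] fun _ => (c : ℝ≥0∞) := by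
        refine ae_le_of_forall_setLIntegral_le_of_sigmaFinite hf fun t ht _ => ?_
        rw [Measure.restrict_restrict ht, setLIntegral_const,
          ← withDensity_apply _ (ht.inter hB), ← hν]
        obtain ⟨N, hN, hNmeas, hN0⟩ := exists_measurable_superset_of_null (ae_iff.1 h)
        have hνN : ν N = 0 := withDensity_absolutelyContinuous μ f hN0
        rw [← measure_sdiff_null hN0, ← measure_sdiff_null hνN]
        refine measure_le_mul_of_eventually_Ico ENNReal.coe_ne_top fun y hy => ?_
        obtain ⟨p, -, hpu, hpos, hlim⟩ := not_not.1 fun hn => hy.2 (hN hn)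
        filter_upwards [hlim.eventually (eventually_lt_nhds (hpu.trans_lt hy.1.2)),
          self_mem_nhdsWithin] with r hr hr0
        rw [div_lt_iff₀ (hpos r hr0)] at hr
        exact htoReal _ _ _ _ (by rw [hcq]; exact hr.le)
      rw [Filter.EventuallyLE, ae_restrict_iff' hB] at hae
      filter_upwards [hae] with y hy _ hqy using hy hqy
    filter_upwards [ae_all_iff.2 key] with y hy
    refine le_of_forall_gt fun a ha => ?_
    obtain ⟨q, hq0, haq, hqb⟩ := ENNReal.lt_iff_exists_rat_btwn.1 ha
    refine (hy q ?_ ?_).trans_lt hqb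
    · exact_mod_cast hq0
    · exact (ENNReal.ofReal_lt_ofReal_iff'.1 haq).1

/-! ### The conditional law of `X` given `Y` under conditional dependence -/

section
variable {Ω : Type*} [MeasurableSpace Ω] {P : Measure Ω} [IsProbabilityMeasure P] {X Y : Ω → ℝ}

theorem tailProb_antitone (X : Ω → ℝ) : Antitone (tailProb P X) := fun _ _ hab =>
  measureReal_mono fun _ hω => lt_of_le_of_lt hab hω

theorem ae_mem_posSupport (hY : Measurable Y) (hYpos : ∀ᵐ ω ∂P, 0 < Y ω) :
    ∀ᵐ y ∂P.map Y, y ∈ posSupport P Y := by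
  have h1 : ∀ᵐ y ∂P.map Y, 0 < y :=
    (ae_map_iff hY.aemeasurable measurableSet_Ioi).2 hYpos
  have h2 : ∀ᵐ y ∂P.map Y, y ∈ (P.map Y).support := Measure.measure_compl_support
  filter_upwards [h1, h2] with y hy0 hy
  refine ⟨hy0, fun δ hδ => ?_⟩
  have := (Measure.mem_support_iff_forall y).1 hy (Ioo (y - δ) (y + δ))
    (Ioo_mem_nhds (by linarith) (by linarith))
  rw [Measure.map_apply hY measurableSet_Ioo] at this
  exact ENNReal.toReal_pos this.ne' (measure_ne_top _ _)

theorem measure_joint_eq_lintegral_condDistrib (hX : Measurable X) (hY : Measurable Y)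
    {A : Set (ℝ × ℝ)} (hA : MeasurableSet A) :
    P {ω | (Y ω, X ω) ∈ A} = ∫⁻ y, condDistrib X Y P y (Prod.mk y ⁻¹' A) ∂P.map Y := by
  rw [← Measure.compProd_apply hA, compProd_map_condDistrib hX.aemeasurable,
    Measure.map_apply (hY.prodMk hX) hA]
  rfl

/-- Identifies the quotients in `HasCondTail` as quotients of a measure with density by its base
measure. -/
theorem withDensity_condDistrib_Ioi (hX : Measurable X) (hY : Measurable Y) (x : ℝ)
    {B : Set ℝ} (hB : MeasurableSet B) :
    (P.map Y).withDensity (fun y => condDistrib X Y P y (Ioi x)) B =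
      P {ω | x < X ω ∧ Y ω ∈ B} := by
  have h : {ω | x < X ω ∧ Y ω ∈ B} = {ω | (Y ω, X ω) ∈ B ×ˢ Ioi x} := by
    ext ω; simp [and_comm]
  rw [h, measure_joint_eq_lintegral_condDistrib hX hY (hB.prod measurableSet_Ioi),
    withDensity_apply _ hB, ← lintegral_indicator hB]
  refine lintegral_congr fun y => ?_
  by_cases hy : y ∈ B <;> simp [hy]

/-- Conditional dependence as a statement on the conditional distribution of `X` given `Y`. -/
theorem IsCondDependent.ae_condDistrib_Ioi {s : ℝ → ℝ} (hCD : IsCondDependent P X Y s)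
    (hX : Measurable X) (hY : Measurable Y) (hYpos : ∀ᵐ ω ∂P, 0 < Y ω)
    (hV : ∀ x, 0 < tailProb P X x) {ε : ℝ} (hε : 0 < ε) :
    ∃ x₀ : ℝ, ∀ᵐ y ∂P.map Y, ∀ x, x₀ ≤ x →
      (1 - ε) * (tailProb P X x * s y) ≤ (condDistrib X Y P y).real (Ioi x) ∧
      (condDistrib X Y P y).real (Ioi x) ≤ (1 + ε) * (tailProb P X x * s y) := by
  have : IsProbabilityMeasure (P.map Y) := Measure.isProbabilityMeasure_map hY.aemeasurable
  obtain ⟨x₀, hx₀⟩ := eventually_atTop.1 (hCD.uniform ε hε)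
  have hmem := ae_mem_posSupport hY hYpos
  have hfix : ∀ x, x₀ ≤ x → ∀ᵐ y ∂P.map Y,
      (1 - ε) * (tailProb P X x * s y) ≤ (condDistrib X Y P y).real (Ioi x) ∧
      (condDistrib X Y P y).real (Ioi x) ≤ (1 + ε) * (tailProb P X x * s y) := by
    intro x hx
    set f : ℝ → ℝ≥0∞ := fun y => condDistrib X Y P y (Ioi x) with hfdef
    have hf : Measurable f := Kernel.measurable_coe _ measurableSet_Ioi
    have hν : ∀ B, MeasurableSet B → (P.map Y).withDensity f B = P {ω | x < X ω ∧ Y ω ∈ B} :=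
      fun B hB => withDensity_condDistrib_Ioi hX hY x hB
    have hfin : IsFiniteMeasure ((P.map Y).withDensity f) :=
      ⟨by rw [hν _ MeasurableSet.univ]; exact measure_lt_top _ _⟩
    obtain ⟨h1, h2⟩ := ae_le_of_tendsto_Ico_ratio (μ := P.map Y) hf
      (l := fun y => (1 - ε) * (tailProb P X x * s y))
      (u := fun y => (1 + ε) * (tailProb P X x * s y))
      ((hCD.measurable.const_mul _).const_mul _) ((hCD.measurable.const_mul _).const_mul _) (by
        filter_upwards [hmem] with y hy
        obtain ⟨p, ⟨hpos, hlim⟩, hp⟩ := hx₀ x hx y hy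
        have hVs : 0 < tailProb P X x * s y := mul_pos (hV x) (hCD.pos y hy.1.le)
        obtain ⟨ha, hb⟩ := abs_le.1 hp
        refine ⟨p, ?_, ?_, fun t ht => ?_, ?_⟩
        · rw [← le_div_iff₀ hVs]; linarith
        · rw [← div_le_iff₀ hVs]; linarith
        · rw [map_measureReal_apply hY measurableSet_Ico]; exact hpos t ht
        · refine hlim.congr fun t => ?_
          rw [map_measureReal_apply hY measurableSet_Ico, measureReal_def, measureReal_def,
            measureReal_def, hν _ measurableSet_Ico]
          rfl)
    filter_upwards [h1, h2, hmem] with y hy1 hy2 hy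
    have hVs : 0 < tailProb P X x * s y := mul_pos (hV x) (hCD.pos y hy.1.le)
    exact ⟨(ENNReal.ofReal_le_iff_le_toReal (measure_ne_top _ _)).1 hy1,
      ENNReal.toReal_le_of_le_ofReal (by positivity) hy2⟩
  -- One null set serves all rational levels; right-continuity of both tails then extends the bounds
  -- to real levels.
  have hrat : ∀ᵐ y ∂P.map Y, ∀ q : ℚ, x₀ ≤ q →
      (1 - ε) * (tailProb P X q * s y) ≤ (condDistrib X Y P y).real (Ioi (q : ℝ)) ∧
      (condDistrib X Y P y).real (Ioi (q : ℝ)) ≤ (1 + ε) * (tailProb P X q * s y) := by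
    rw [ae_all_iff]
    intro q
    by_cases hq : x₀ ≤ q
    · filter_upwards [hfix q hq] with y hy _ using hy
    · exact Eventually.of_forall fun y h => absurd h hq
  refine ⟨x₀, ?_⟩
  filter_upwards [hrat] with y hy x hx
  obtain ⟨q, hqgt, hqlt, hqlim⟩ := Real.exists_seq_rat_strictAnti_tendsto x
  have hlim : ∀ (Q : Measure ℝ) [IsFiniteMeasure Q],
      Tendsto (fun n => Q.real (Ioi (q n : ℝ))) atTop (𝓝 (Q.real (Ioi x))) := by
    intro Q _
    have hmono : Monotone fun n => Ioi (q n : ℝ) := fun m n hmn =>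
      Ioi_subset_Ioi (by exact_mod_cast hqgt.antitone hmn)
    have hU : ⋃ n, Ioi (q n : ℝ) = Ioi x := by
      refine Subset.antisymm (iUnion_subset fun n => Ioi_subset_Ioi (hqlt n).le) fun z hz => ?_
      obtain ⟨n, hn⟩ := (hqlim.eventually (eventually_lt_nhds (mem_Ioi.1 hz))).exists
      exact mem_iUnion.2 ⟨n, hn⟩
    have := tendsto_measure_iUnion_atTop (μ := Q) hmono
    rw [hU] at this
    exact (ENNReal.tendsto_toReal (measure_ne_top _ _)).comp this
  have htail : ∀ z, tailProb P X z = (P.map X).real (Ioi z) := fun z => by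
    rw [map_measureReal_apply hX measurableSet_Ioi]; rfl
  have hVlim : Tendsto (fun n => tailProb P X (q n)) atTop (𝓝 (tailProb P X x)) := by
    simp_rw [htail]
    have : IsProbabilityMeasure (P.map X) := Measure.isProbabilityMeasure_map hX.aemeasurable
    exact hlim _
  have hκ := hlim (condDistrib X Y P y)
  exact ⟨le_of_tendsto_of_tendsto' ((hVlim.mul_const _).const_mul _) hκ
      fun n => (hy (q n) (hx.trans (hqlt n).le)).1,
    le_of_tendsto_of_tendsto' hκ ((hVlim.mul_const _).const_mul _)
      fun n => (hy (q n) (hx.trans (hqlt n).le)).2⟩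

end

/-! ### Regularly varying tails -/

theorem IsRegularlyVaryingTail.pos {V : ℝ → ℝ} {α : ℝ} (h : IsRegularlyVaryingTail V α)
    (hanti : Antitone V) (h0 : ∀ x, 0 ≤ V x) (x : ℝ) : 0 < V x := by
  have h1 := h.2 1 one_pos
  rw [Real.one_rpow] at h1
  obtain ⟨z, hz, hxz⟩ := ((h1.eventually (eventually_gt_nhds one_pos)).and
    (eventually_ge_atTop x)).exists
  have : V z ≠ 0 := by intro e; simp [e] at hz
  exact (lt_of_le_of_ne (h0 z) this.symm).trans_le (hanti hxz)

/-- The upper Potter bound for monotone regularly varying tails. -/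
theorem IsRegularlyVaryingTail.exists_potter {V : ℝ → ℝ} {α : ℝ}
    (h : IsRegularlyVaryingTail V α) (hanti : Antitone V) (hpos : ∀ x, 0 < V x) {ε : ℝ}
    (hε : 0 < ε) :
    ∃ D x₀ : ℝ, 0 ≤ D ∧ ∀ x y, 1 ≤ y → x₀ ≤ x / y → V (x / y) ≤ D * y ^ (α + ε) * V x := by
  have hβ : 0 < α + ε := by linarith [h.1]
  set c : ℝ := 2 ^ (α + ε) with hc
  have hc0 : 0 < c := by positivity
  have h2 := h.2 (1 / 2) (by norm_num)
  -- Halving the argument multiplies `V` by about `2^α < c`; iterating along powers of 2 gives the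
  -- bound.
  have hlt : ((1 : ℝ) / 2) ^ (-α) < c := by
    rw [one_div, Real.inv_rpow zero_le_two, ← Real.rpow_neg zero_le_two, neg_neg]
    exact Real.rpow_lt_rpow_of_exponent_lt one_lt_two (by linarith)
  obtain ⟨x₁, hx₁⟩ := eventually_atTop.1 (h2.eventually (eventually_lt_nhds hlt))
  have hstep : ∀ x, x₁ ≤ x → V (x / 2) ≤ c * V x := fun x hx => by
    have := hx₁ x hx
    rw [div_lt_iff₀ (hpos x), mul_one_div] at this
    exact this.le
  have hiter : ∀ (n : ℕ) (x : ℝ), 0 ≤ x → x₁ ≤ x / 2 ^ n →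
      V (x / 2 ^ (n + 1)) ≤ c ^ (n + 1) * V x := by
    intro n x hx0
    induction n with
    | zero => intro hx; simpa using hstep x (by simpa using hx)
    | succ n ih =>
      intro hx
      have hle : x / 2 ^ (n + 1) ≤ x / 2 ^ n := by
        gcongr
        · norm_num
        · omega
      calc V (x / 2 ^ (n + 1 + 1)) = V (x / 2 ^ (n + 1) / 2) := by
            rw [pow_succ _ (n + 1), div_mul_eq_div_div]
        _ ≤ c * V (x / 2 ^ (n + 1)) := hstep _ hx
        _ ≤ c * (c ^ (n + 1) * V x) := mul_le_mul_of_nonneg_left (ih (hx.trans hle)) hc0.le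
        _ = c ^ (n + 1 + 1) * V x := by ring
  refine ⟨c, max x₁ 0, hc0.le, fun x y hy hxy => ?_⟩
  obtain ⟨n, hn1, hn2⟩ := exists_nat_pow_near hy one_lt_two
  have hy0 : 0 < y := by linarith
  have hx0 : 0 ≤ x := by
    have := (le_max_right x₁ 0).trans hxy
    rwa [le_div_iff₀ hy0, zero_mul] at this
  have hpow : c ^ (n + 1) ≤ c * y ^ (α + ε) := by
    rw [pow_succ', hc, ← Real.rpow_mul_natCast zero_le_two, mul_comm (α + ε) n,
      Real.rpow_natCast_mul zero_le_two]
    gcongr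
  calc V (x / y) ≤ V (x / 2 ^ (n + 1)) := hanti (by gcongr)
    _ ≤ c ^ (n + 1) * V x := hiter n x hx0 (((le_max_left _ _).trans hxy).trans (by gcongr))
    _ ≤ c * y ^ (α + ε) * V x := mul_le_mul_of_nonneg_right hpow (hpos x).le

/-! ### Tail of the product by dominated convergence -/

section
variable {Ω : Type*} [MeasurableSpace Ω] {P : Measure Ω} [IsProbabilityMeasure P] {X Y : Ω → ℝ}

theorem measureReal_joint_eq_integral_condDistrib (hX : Measurable X) (hY : Measurable Y)
    {A : Set (ℝ × ℝ)} (hA : MeasurableSet A) :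
    P.real {ω | (Y ω, X ω) ∈ A} =
      ∫ y, (condDistrib X Y P y).real (Prod.mk y ⁻¹' A) ∂P.map Y := by
  rw [measureReal_def, measure_joint_eq_lintegral_condDistrib hX hY hA]
  exact (integral_toReal (Kernel.measurable_kernel_prodMk_left hA).aemeasurable
    (Eventually.of_forall fun y => measure_lt_top _ _)).symm

theorem IsCondDependent.ae_tendsto_condDistrib {s : ℝ → ℝ} (hCD : IsCondDependent P X Y s)
    (hX : Measurable X) (hY : Measurable Y) (hYpos : ∀ᵐ ω ∂P, 0 < Y ω)
    (hV : ∀ x, 0 < tailProb P X x) :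
    ∀ᵐ y ∂P.map Y, Tendsto (fun x => (condDistrib X Y P y).real (Ioi x) / tailProb P X x)
      atTop (𝓝 (s y)) := by
  have h : ∀ n : ℕ, ∃ x₀ : ℝ, ∀ᵐ y ∂P.map Y, ∀ x, x₀ ≤ x →
      (1 - 1 / ((n : ℝ) + 1)) * (tailProb P X x * s y) ≤ (condDistrib X Y P y).real (Ioi x) ∧
      (condDistrib X Y P y).real (Ioi x) ≤ (1 + 1 / ((n : ℝ) + 1)) * (tailProb P X x * s y) :=
    fun n => hCD.ae_condDistrib_Ioi hX hY hYpos hV (by positivity)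
  choose x₀ hx₀ using h
  filter_upwards [ae_all_iff.2 hx₀, ae_mem_posSupport hY hYpos] with y hy hy0
  have hs := hCD.pos y hy0.1.le
  rw [Metric.tendsto_atTop]
  intro ε hε
  obtain ⟨n, hn⟩ := exists_nat_one_div_lt (div_pos hε hs)
  rw [lt_div_iff₀ hs] at hn
  refine ⟨x₀ n, fun x hx => ?_⟩
  obtain ⟨h1, h2⟩ := hy n x hx
  rw [mul_left_comm, mul_comm, ← le_div_iff₀ (hV x)] at h1
  rw [mul_left_comm, mul_comm (tailProb P X x), ← div_le_iff₀ (hV x)] at h2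
  rw [Real.dist_eq, abs_lt]
  constructor <;> nlinarith

/-- `s` is almost everywhere bounded: at one fixed level, half of `V x₀ * s y` is at most a
conditional probability, hence at most 1. -/
theorem IsCondDependent.integrable {s : ℝ → ℝ} (hCD : IsCondDependent P X Y s)
    (hX : Measurable X) (hY : Measurable Y) (hYpos : ∀ᵐ ω ∂P, 0 < Y ω)
    (hV : ∀ x, 0 < tailProb P X x) : Integrable s (P.map Y) := by
  have : IsProbabilityMeasure (P.map Y) := Measure.isProbabilityMeasure_map hY.aemeasurable
  obtain ⟨x₀, hx₀⟩ := hCD.ae_condDistrib_Ioi hX hY hYpos hV (one_half_pos (α := ℝ))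
  refine Integrable.of_bound hCD.measurable.aestronglyMeasurable (2 / tailProb P X x₀) ?_
  filter_upwards [hx₀, ae_mem_posSupport hY hYpos] with y hy hy0
  rw [Real.norm_of_nonneg (hCD.pos y hy0.1.le).le, le_div_iff₀ (hV x₀)]
  have h1 := (hy x₀ le_rfl).1
  have h2 : (condDistrib X Y P y).real (Ioi x₀) ≤ 1 := measureReal_le_one
  linarith

/-- Asymptotics of `P (X Y > x, Y ≤ b x)`, given a domination of `V (x / y) / V x` there. -/
theorem IsCondDependent.tendsto_tail_mul_truncated {s : ℝ → ℝ} (hCD : IsCondDependent P X Y s)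
    (hX : Measurable X) (hY : Measurable Y) (hYpos : ∀ᵐ ω ∂P, 0 < Y ω) {α : ℝ}
    (hF : IsRegularlyVaryingTail (tailProb P X) α) (hV : ∀ x, 0 < tailProb P X x)
    {x₁ : ℝ} (hx₁ : ∀ᵐ y ∂P.map Y, ∀ x, x₁ ≤ x →
      (condDistrib X Y P y).real (Ioi x) ≤ 2 * (tailProb P X x * s y))
    {b : ℝ → ℝ} (hb : Tendsto b atTop atTop)
    (hbx : ∀ᶠ x in atTop, ∀ y, 0 < y → y ≤ b x → x₁ ≤ x / y) {β D : ℝ} (hD : 0 ≤ D)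
    (hdom : ∀ᶠ x in atTop, ∀ y, 1 ≤ y → y ≤ b x →
      tailProb P X (x / y) ≤ D * y ^ β * tailProb P X x)
    (hint : Integrable (fun y => y ^ β * s y) (P.map Y)) :
    Tendsto (fun x => P.real {ω | x < X ω * Y ω ∧ Y ω ≤ b x} / tailProb P X x) atTop
      (𝓝 (∫ y, y ^ α * s y ∂P.map Y)) := by
  have hpos := ae_mem_posSupport hY hYpos
  let A : ℝ → Set (ℝ × ℝ) := fun x => {z | x < z.2 * z.1 ∧ z.1 ≤ b x}
  have hA : ∀ x, MeasurableSet (A x) := fun x =>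
    (measurableSet_lt measurable_const (measurable_snd.mul measurable_fst)).inter
      (measurableSet_le measurable_fst measurable_const)
  have hsec : ∀ x y, 0 < y → y ≤ b x → Prod.mk y ⁻¹' A x = Ioi (x / y) := by
    intro x y hy hyb
    ext u
    simp [A, hyb, div_lt_iff₀ hy]
  have hsec0 : ∀ x y, b x < y → Prod.mk y ⁻¹' A x = ∅ := by
    intro x y hy
    ext u
    simp [A, hy]
  have heq : ∀ x, P.real {ω | x < X ω * Y ω ∧ Y ω ≤ b x} / tailProb P X x =
      ∫ y, (condDistrib X Y P y).real (Prod.mk y ⁻¹' A x) / tailProb P X x ∂P.map Y := by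
    intro x
    rw [integral_div, ← measureReal_joint_eq_integral_condDistrib hX hY (hA x)]
    rfl
  simp_rw [heq]
  refine tendsto_integral_filter_of_dominated_convergence
    -- The term `s y` handles y ≤ 1, the other 1 ≤ y ≤ b(x); beyond b(x) the section is empty.
    (fun y => 2 * (s y + D * (y ^ β * s y))) (Eventually.of_forall fun x => ?_) ?_
    (((hCD.integrable hX hY hYpos hV).add (hint.const_mul D)).const_mul 2) ?_
  · exact ((Kernel.measurable_kernel_prodMk_left (hA x)).ennreal_toReal.div_const
      _).aestronglyMeasurable
  · filter_upwards [hbx, hdom, eventually_ge_atTop 0] with x hx hdx hx0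
    filter_upwards [hx₁, hpos] with y hy hy0
    have hs := hCD.pos y hy0.1.le
    have hyβ : 0 ≤ y ^ β := Real.rpow_nonneg hy0.1.le _
    rw [Real.norm_of_nonneg (div_nonneg measureReal_nonneg (hV x).le)]
    by_cases hyb : y ≤ b x
    · rw [hsec x y hy0.1 hyb, div_le_iff₀ (hV x)]
      have hratio : tailProb P X (x / y) ≤ (1 + D * y ^ β) * tailProb P X x := by
        rcases le_total 1 y with h1 | h1
        · have := hdx y h1 hyb
          nlinarith [hV x]
        · have hxy : x ≤ x / y := le_div_self hx0 hy0.1 h1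
          have := tailProb_antitone (P := P) X hxy
          have : 0 ≤ D * y ^ β * tailProb P X x := by have := hV x; positivity
          linarith
      calc (condDistrib X Y P y).real (Ioi (x / y))
          ≤ 2 * (tailProb P X (x / y) * s y) := hy _ (hx y hy0.1 hyb)
        _ ≤ 2 * ((1 + D * y ^ β) * tailProb P X x * s y) := by gcongr
        _ = 2 * (s y + D * (y ^ β * s y)) * tailProb P X x := by ring
    · rw [hsec0 x y (not_le.1 hyb)]
      simp only [measureReal_empty, zero_div]
      positivity
  · filter_upwards [hCD.ae_tendsto_condDistrib hX hY hYpos hV, hpos] with y hy hy0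
    have h1 := hF.2 y⁻¹ (inv_pos.2 hy0.1)
    rw [Real.inv_rpow hy0.1.le, ← Real.rpow_neg hy0.1.le, neg_neg] at h1
    have h2 := h1.mul (hy.comp (tendsto_id.atTop_div_const hy0.1))
    refine h2.congr' ?_
    filter_upwards [hb.eventually_ge_atTop y] with x hx
    rw [hsec x y hy0.1 hx, ← div_eq_mul_inv]
    have := (hV (x / y)).ne'
    simp only [Function.comp, id]
    field_simp

/-- If moreover `P (Y > b x) = o(P (X > x))`, the truncation is immaterial. -/
theorem IsCondDependent.tail_mul_isEquivalent {s : ℝ → ℝ} (hCD : IsCondDependent P X Y s)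
    (hY : Measurable Y) (hYpos : ∀ᵐ ω ∂P, 0 < Y ω) {α : ℝ}
    (hV : ∀ x, 0 < tailProb P X x)
    (hint : Integrable (fun ω => Y ω ^ α * s (Y ω)) P) {b : ℝ → ℝ}
    (hlim : Tendsto (fun x => P.real {ω | x < X ω * Y ω ∧ Y ω ≤ b x} / tailProb P X x) atTop
      (𝓝 (∫ y, y ^ α * s y ∂P.map Y)))
    (hb : (fun x => tailProb P Y (b x)) =o[atTop] tailProb P X) :
    tailProb P (fun ω => X ω * Y ω) ~[atTop]
      fun x => (∫ ω, Y ω ^ α * s (Y ω) ∂P) * tailProb P X x := by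
  have hm : Measurable fun y : ℝ => y ^ α * s y := (measurable_id.pow_const α).mul hCD.measurable
  rw [integral_map hY.aemeasurable hm.aestronglyMeasurable] at hlim
  -- Positivity of the constant lets the equivalence be read off from a quotient.
  have hEpos : 0 < ∫ ω, Y ω ^ α * s (Y ω) ∂P := by
    have hae : ∀ᵐ ω ∂P, 0 < Y ω ^ α * s (Y ω) := by
      filter_upwards [hYpos] with ω hω
      exact mul_pos (Real.rpow_pos_of_pos hω _) (hCD.pos _ hω.le)
    have h0 := hae.mono fun ω h => h.le
    refine (integral_nonneg_of_ae h0).lt_of_ne fun he => ?_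
    obtain ⟨ω, h1, h2⟩ :=
      (hae.and ((integral_eq_zero_iff_of_nonneg_ae h0 hint).1 he.symm)).exists
    exact h1.ne' h2
  set E := ∫ ω, Y ω ^ α * s (Y ω) ∂P with hE
  have htail : Tendsto (fun x => tailProb P (fun ω => X ω * Y ω) x / tailProb P X x) atTop
      (𝓝 E) := by
    have hup := hlim.add hb.tendsto_div_nhds_zero
    rw [add_zero] at hup
    refine tendsto_of_tendsto_of_tendsto_of_le_of_le hlim hup (fun x => ?_) (fun x => ?_)
    · exact div_le_div_of_nonneg_right (measureReal_mono fun ω hω => hω.1) (hV x).le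
    · dsimp only
      rw [← add_div]
      refine div_le_div_of_nonneg_right ?_ (hV x).le
      refine (measureReal_mono fun ω hω => ?_).trans (measureReal_union_le _ _)
      rcases le_or_gt (Y ω) (b x) with h | h
      · exact Or.inl ⟨hω, h⟩
      · exact Or.inr h
  rw [isEquivalent_iff_tendsto_one
    (Eventually.of_forall fun x => (mul_pos hEpos (hV x)).ne')]
  have h := htail.div_const E
  rw [div_self hEpos.ne'] at h
  refine h.congr fun x => ?_
  rw [Pi.div_apply, div_div, mul_comm E]

end

/-! ### The two cases of the theorem -/

theorem theorem2p1 {Ω : Type*} [MeasurableSpace Ω] (P : Measure Ω) [IsProbabilityMeasure P]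
    (X Y : Ω → ℝ) (hX : Measurable X) (hY : Measurable Y) (hYpos : ∀ᵐ ω ∂P, 0 < Y ω)
    (s : ℝ → ℝ) (hCD : IsCondDependent P X Y s)
    (α : ℝ) (hF : IsRegularlyVaryingTail (tailProb P X) α)
    (L : ℝ → ℝ) (hL : IsSlowlyVarying L)
    (hFL : tailProb P X ~[atTop] fun x => x ^ (-α) * L x)
    (hG : tailProb P Y =o[atTop] tailProb P X)
    (h : (∃ ε : ℝ, 0 < ε ∧ Integrable (fun ω => Y ω ^ (α + ε) * s (Y ω)) P) ∨
      ((∃ g : ℝ → ℝ, IsAuxiliary (tailProb P Y) (tailProb P X) g ∧ HasBoundedRatio L g) ∧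
        Integrable (fun ω => Y ω ^ α * s (Y ω)) P)) :
    Integrable (fun ω => Y ω ^ α * s (Y ω)) P ∧
      tailProb P (fun ω => X ω * Y ω) ~[atTop]
        fun x => (∫ ω, Y ω ^ α * s (Y ω) ∂P) * tailProb P X x := by
  have hanti : Antitone (tailProb P X) := tailProb_antitone X
  have hV : ∀ x, 0 < tailProb P X x := hF.pos hanti fun x => measureReal_nonneg
  have hm : ∀ γ : ℝ, Measurable fun y : ℝ => y ^ γ * s y := fun γ =>
    (measurable_id.pow_const γ).mul hCD.measurable
  have hmap : ∀ {γ : ℝ}, Integrable (fun ω => Y ω ^ γ * s (Y ω)) P →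
      Integrable (fun y => y ^ γ * s y) (P.map Y) := fun {γ} hγ =>
    (integrable_map_measure (hm γ).aestronglyMeasurable hY.aemeasurable).2 hγ
  obtain ⟨x₁, hx₁⟩ := hCD.ae_condDistrib_Ioi hX hY hYpos hV one_pos
  have hx₁' : ∀ᵐ y ∂P.map Y, ∀ x, x₁ ≤ x →
      (condDistrib X Y P y).real (Ioi x) ≤ 2 * (tailProb P X x * s y) := by
    filter_upwards [hx₁] with y hy x hx
    rw [← one_add_one_eq_two]
    exact (hy x hx).2
  rcases h with ⟨ε, hε, hint⟩ | ⟨⟨g, hg, C, hC⟩, hint⟩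
  · have hintα : Integrable (fun ω => Y ω ^ α * s (Y ω)) P := by
      have hs : Integrable (fun ω => s (Y ω)) P :=
        (hCD.integrable hX hY hYpos hV).comp_measurable hY
      refine (hs.add hint).mono' ((hm α).comp hY).aestronglyMeasurable ?_
      filter_upwards [hYpos] with ω hω
      have hsω := hCD.pos _ hω.le
      have h1 := Real.rpow_pos_of_pos hω α
      have h2 := Real.rpow_pos_of_pos hω (α + ε)
      rw [Real.norm_of_nonneg (by positivity)]
      have h3 : Y ω ^ α ≤ 1 + Y ω ^ (α + ε) := by
        rcases le_total (Y ω) 1 with h | h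
        · linarith [Real.rpow_le_one hω.le h hF.1]
        · linarith [Real.rpow_le_rpow_of_exponent_le h (show α ≤ α + ε by linarith)]
      simp only [Pi.add_apply]
      nlinarith
    refine ⟨hintα, ?_⟩
    obtain ⟨D, x₂, hD, hpot⟩ := hF.exists_potter hanti hV hε
    -- For y ≤ x/m one has x/y ≥ m, so both the conditional bound and the Potter bound apply at x/y.
    set m := max (max x₁ x₂) 1 with hmdef
    have hm0 : 0 < m := one_pos.trans_le (le_max_right _ _)
    have hmy : ∀ x y : ℝ, 0 < y → y ≤ x / m → m ≤ x / y := fun x y hy hyx => by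
      rw [le_div_iff₀ hm0] at hyx
      rw [le_div_iff₀ hy]
      linarith
    have hb : Tendsto (fun x : ℝ => x / m) atTop atTop := tendsto_id.atTop_div_const hm0
    refine hCD.tail_mul_isEquivalent hY hYpos hV hintα (b := fun x => x / m)
      (hCD.tendsto_tail_mul_truncated hX hY hYpos hF hV hx₁' hb
        (Eventually.of_forall fun x y hy hyx =>
          ((le_max_left _ _).trans (le_max_left _ _)).trans (hmy x y hy hyx)) hD
        (Eventually.of_forall fun x y hy hyx => hpot x y hy
          (((le_max_right _ _).trans (le_max_left _ _)).trans
            (hmy x y (one_pos.trans_le hy) hyx))) (hmap hint)) ?_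
    -- P(Y > x/m) = o(V(x/m)), and V(x/m) = O(V x) by regular variation.
    refine (hG.comp_tendsto hb).trans_isBigO ?_
    have hratio := hF.2 m⁻¹ (inv_pos.2 hm0)
    refine isBigO_of_div_tendsto_nhds (Eventually.of_forall fun x h => absurd h (hV x).ne')
      _ (hratio.congr fun x => ?_)
    simp [div_eq_mul_inv]
  · refine ⟨hint, ?_⟩
    -- For y ≤ x g(x), x/y ≥ 1/g(x) → ∞, so asymptotic bounds hold at x/y uniformly in y.
    have hginv : Tendsto (fun x => (g x)⁻¹) atTop atTop :=
      tendsto_inv_nhdsGT_zero.comp (tendsto_nhdsWithin_iff.2 ⟨hg.tendsto_zero,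
        (eventually_ge_atTop 0).mono fun x hx => hg.pos x hx⟩)
    have hinv : ∀ x y : ℝ, 0 < x → 0 < y → y ≤ x * g x → (g x)⁻¹ ≤ x / y := fun x y hx hy hyx => by
      rw [le_div_iff₀ hy, inv_mul_le_iff₀ (hg.pos x hx.le)]
      linarith
    have hcomp : ∀ᶠ x in atTop, tailProb P X x ≤ 2 * (x ^ (-α) * L x) ∧
        x ^ (-α) * L x ≤ 2 * tailProb P X x := by
      filter_upwards [hFL.isLittleO.bound (one_half_pos (α := ℝ)), hL.1, eventually_gt_atTop 0]
        with x hx hLx hx0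
      have hW : 0 < x ^ (-α) * L x := mul_pos (Real.rpow_pos_of_pos hx0 _) hLx
      rw [Real.norm_of_nonneg hW.le, Pi.sub_apply, Real.norm_eq_abs, abs_le] at hx
      constructor <;> linarith [hx.1, hx.2]
    refine hCD.tail_mul_isEquivalent hY hYpos hV hint (b := fun x => x * g x)
      (hCD.tendsto_tail_mul_truncated hX hY hYpos hF hV hx₁' hg.tendsto_atTop ?_
        -- The 4 is 2 · 2: `V` is compared with `x^(-α) L x` once at x/y and once at x.
        (D := 4 * max C 0) (by positivity) ?_ (hmap hint)) hg.isLittleO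
    · filter_upwards [hginv.eventually_ge_atTop x₁, eventually_gt_atTop 0] with x hx hx0 y hy hyx
      exact hx.trans (hinv x y hx0 hy hyx)
    · obtain ⟨z, hz⟩ := eventually_atTop.1 hcomp
      filter_upwards [hginv.eventually_ge_atTop z, eventually_gt_atTop 0, hcomp, hC, hL.1]
        with x hx hx0 hlx hCx hLx y hy hyx
      have hy0 : 0 < y := one_pos.trans_le hy
      have hLy : L (x / y) ≤ max C 0 * L x := by
        have := hCx y hy hyx
        rw [div_le_iff₀ hLx] at this
        exact this.trans (mul_le_mul_of_nonneg_right (le_max_left _ _) hLx.le)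
      have hxα : 0 < x ^ (-α) := Real.rpow_pos_of_pos hx0 _
      have hyα : 0 < y ^ α := Real.rpow_pos_of_pos hy0 _
      have hpow : (x / y) ^ (-α) = x ^ (-α) * y ^ α := by
        rw [Real.div_rpow hx0.le hy0.le, Real.rpow_neg hy0.le, div_inv_eq_mul]
      calc tailProb P X (x / y) ≤ 2 * ((x / y) ^ (-α) * L (x / y)) :=
            (hz _ (hx.trans (hinv x y hx0 hy0 hyx))).1
        _ ≤ 2 * (x ^ (-α) * y ^ α * (max C 0 * L x)) := by rw [hpow]; gcongr
        _ = 2 * max C 0 * y ^ α * (x ^ (-α) * L x) := by ring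
        _ ≤ 2 * max C 0 * y ^ α * (2 * tailProb P X x) :=
            mul_le_mul_of_nonneg_left hlx.2 (by positivity)
        _ = 4 * max C 0 * y ^ α * tailProb P X x := by ring
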